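/- Let $p>3$ be a prime, let $\mathbb{Z}_p$ be the ring of $p$-adic integers, and let $\mathbb{Z}_p[\beta]$ be the polynomial ring over it in the indeterminate $\beta$. Put $\alpha=1-\beta$ and $x=\beta(1-\beta)$. For a positive integer $d$ and $f\in\mathbb{Z}_p[\beta]$ let $$\pounds_d(f)=\sum_{k=1}^{p-1}\frac{f^k}{k^d}$$ be the finite polylogarithm, and for $1\le k\le p-1$ let $H_k^{(2)}=\sum_{j=1}^{k}1/j^2$; these have coefficients in $\mathbb{Z}_p$, since the integers $1,\dots,p-1$ are invertible in $\mathbb{Z}_p$. Then the following three congruences hold in $\mathbb{Z}_p[\beta]$ modulo the ideal generated by $p$: $$\sum_{k=1}^{p-1}\binom{2k}{k}\frac{x^k}{k}\equiv \pounds_1(\alpha)+\pounds_1(\beta)\pmod p,$$ $$\sum_{k=1}^{p-1}\binom{2k}{k}\frac{x^k}{k^2}\equiv 2\pounds_2(\alpha)+2\pounds_2(\beta)\pmod p,$$ $$\sum_{k=1}^{p-1}\binom{2k}{k}\left(\frac{H_k^{(2)}}{k}+\frac{1}{k^3}\right)x^k\equiv 4\pounds_3(\alpha)+4\pounds_3(\beta)\pmod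 p.$$ -/

import Mathlib

open Polynomial

noncomputable section

/-- The reciprocal `1 / n` of a natural number `n`, as an element of `ℤ_p`. It is only used
for `n` coprime to `p`, where it is the inverse of `n`; see `padicRecip_mul_cancel` and
`coe_padicRecip`. -/
def padicRecip (p : ℕ) [Fact p.Prime] (n : ℕ) : ℤ_[p] := Ring.inverse (n : ℤ_[p])

theorem padicRecip_mul_cancel (p : ℕ) [Fact p.Prime] {n : ℕ} (h : p.Coprime n) :
    padicRecip p n * (n : ℤ_[p]) = 1 := by
  apply Ring.inverse_mul_cancel
  rw [PadicInt.isUnit_iff]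
  exact_mod_cast PadicInt.norm_natCast_eq_one_iff.mpr h

theorem coe_padicRecip (p : ℕ) [Fact p.Prime] {n : ℕ} (h : p.Coprime n) :
    (padicRecip p n : ℚ_[p]) = 1 / (n : ℚ_[p]) := by
  have h1 : (padicRecip p n : ℚ_[p]) * (n : ℚ_[p]) = 1 := by
    exact_mod_cast congrArg (fun z : ℤ_[p] => (z : ℚ_[p])) (padicRecip_mul_cancel p h)
  exact eq_one_div_of_mul_eq_one_left h1

/-- The generalized harmonic number `H_k^{(d)} = ∑_{j=1}^k 1 / j^d` in `ℤ_p`, for `k < p`. -/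
def genHarmonic (p : ℕ) [Fact p.Prime] (d k : ℕ) : ℤ_[p] :=
  ∑ j ∈ Finset.Icc 1 k, padicRecip p (j ^ d)

/-- The finite polylogarithm `£_d(f) = ∑_{k=1}^{p-1} f^k / k^d`, evaluated at a polynomial `f`
with coefficients in `ℤ_p`. -/
def finitePolylog (p : ℕ) [Fact p.Prime] (d : ℕ) (f : ℤ_[p][X]) : ℤ_[p][X] :=
  ∑ k ∈ Finset.Icc 1 (p - 1), C (padicRecip p (k ^ d)) * f ^ k

end

namespace FinitePolylog

open Finset

variable (p : ℕ) [Fact p.Prime]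

/-! Reduce modulo `p` and differentiate in `β`. Over `ZMod p`, a polynomial of degree at most `p`
with zero derivative is `a + b X ^ p`, so it vanishes once it is zero at `0` and `1`; each identity
thus follows by comparing derivatives and endpoint values. The recurrence for central binomials
makes `(1 - 4x) F' - 2F` again a central binomial series, with differenced coefficients. Since `1 -
4x = (1 - 2β)²`, this is the `β`-derivative of `(1 - 2β) F(x)` (`derivative_mul_centralSum_comp`).
Constant coefficients give `(1 - 2β) F(x) = 1 - 2β^p`. Integrating gives weights `1/k`, then `1/k²`;
these two determine the series with weights `H_k^{(2)} + 1/k²`, and one more integration gives the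
third congruence. -/

/-- The finite polylogarithm as a polynomial over `ZMod p`; the summand for `k = 0` vanishes
when `0 < d`. -/
noncomputable def polylog (d : ℕ) : (ZMod p)[X] :=
  ∑ k ∈ range p, C (((k : ZMod p) ^ d)⁻¹) * X ^ k

/-- The truncated series `∑_{k < p} (2k choose k) a_k X ^ k` over `ZMod p`. -/
noncomputable def centralSum (a : ℕ → ZMod p) : (ZMod p)[X] :=
  ∑ k ∈ range p, C ((k.centralBinom : ZMod p) * a k) * X ^ k

variable {p}

theorem eq_zero_of_derivative_eq_zero {P : (ZMod p)[X]} (hdeg : P.natDegree ≤ p)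
    (hd : derivative P = 0) (h0 : P.eval 0 = 0) (h1 : P.eval 1 = 0) : P = 0 := by
  have hp := (Fact.out : p.Prime).pos
  have hP : P = C (P.coeff p) * X ^ p := by
    ext n
    rw [coeff_C_mul, coeff_X_pow]
    rcases lt_trichotomy n p with h | h | h
    · rw [if_neg h.ne, mul_zero]
      rcases n with _ | n
      · rw [coeff_zero_eq_eval_zero, h0]
      · have h2 : (derivative P).coeff n = 0 := by rw [hd, coeff_zero]
        rw [coeff_derivative] at h2
        refine (mul_eq_zero.mp h2).resolve_right ?_
        rw [← Nat.cast_succ, ZMod.natCast_eq_zero_iff]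
        exact fun h3 => absurd (Nat.le_of_dvd n.succ_pos h3) (by omega)
    · simp [h]
    · rw [if_neg h.ne', mul_zero, coeff_eq_zero_of_natDegree_lt (by omega)]
  rw [hP] at h1
  simp only [eval_mul, eval_C, eval_pow, eval_X, one_pow, mul_one] at h1
  rw [hP, h1, C_0, zero_mul]

theorem eq_zero_of_mul_derivative_eq_zero {P : (ZMod p)[X]} (hdeg : P.natDegree ≤ p)
    (hd : X * (1 - X) * derivative P = 0) (h0 : P.eval 0 = 0) (h1 : P.eval 1 = 0) : P = 0 := by
  refine eq_zero_of_derivative_eq_zero hdeg ((mul_eq_zero.mp hd).resolve_left ?_) h0 h1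
  refine mul_ne_zero X_ne_zero fun h => ?_
  simpa using congrArg (eval 0) h

/-! ### Recurrences for truncated central binomial series -/

theorem sum_range_shift {f : ℕ → ZMod p} (h0 : f 0 = 0) (hp : f p = 0) :
    ∑ k ∈ range p, C (f k) * X ^ k = X * ∑ k ∈ range p, C (f (k + 1)) * X ^ k := by
  have h := Finset.sum_range_succ (fun k => C (f k) * (X : (ZMod p)[X]) ^ k) p
  rw [Finset.sum_range_succ'] at h
  simp only [hp, h0, C_0, zero_mul, add_zero] at h
  rw [← h, mul_sum]
  exact sum_congr rfl fun k _ => by ring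

theorem centralBinom_succ_mul (k : ℕ) :
    ((k : ZMod p) + 1) * ((k + 1).centralBinom : ZMod p) =
      (4 * k + 2) * (k.centralBinom : ZMod p) := by
  have h := congrArg (Nat.cast : ℕ → ZMod p) (Nat.succ_mul_centralBinom_succ k)
  push_cast at h
  rw [h]; ring

theorem natCast_ne_zero {k : ℕ} (h0 : k ≠ 0) (hk : k < p) : (k : ZMod p) ≠ 0 := by
  rw [Ne, ZMod.natCast_eq_zero_iff]
  exact fun h => absurd (Nat.le_of_dvd (Nat.pos_of_ne_zero h0) h) (by omega)

theorem centralBinom_eq_zero {k : ℕ} (h1 : p < 2 * k) (h2 : k < p) :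
    (k.centralBinom : ZMod p) = 0 := by
  rw [ZMod.natCast_eq_zero_iff, Nat.centralBinom_eq_two_mul_choose]
  exact (Fact.out : p.Prime).dvd_choose h2 (by omega) h1.le

theorem X_mul_derivative_centralSum (a : ℕ → ZMod p) :
    X * derivative (centralSum p a) = centralSum p fun k => k * a k := by
  simp only [centralSum, derivative_sum, mul_sum, derivative_C_mul_X_pow]
  refine sum_congr rfl fun k _ => ?_
  rcases k with _ | k
  · simp
  · simp only [Nat.add_sub_cancel, map_mul, pow_succ]
    ring

theorem centralSum_ode (a : ℕ → ZMod p) :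
    (1 - 4 * X) * derivative (centralSum p a) - 2 * centralSum p a =
      centralSum p fun k => (4 * k + 2) * (a (k + 1) - a k) := by
  refine mul_left_cancel₀ X_ne_zero ?_
  have h : X * derivative (centralSum p a) = X * ∑ k ∈ range p,
      C ((4 * k + 2) * (k.centralBinom : ZMod p) * a (k + 1)) * X ^ k := by
    -- The factor `k` vanishes at both `0` and `p`, so truncation leaves no boundary term.
    rw [X_mul_derivative_centralSum, centralSum, sum_range_shift (by simp) (by simp)]
    congr 1
    refine sum_congr rfl fun k _ => ?_
    rw [← centralBinom_succ_mul]
    push_cast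
    congr 2
    ring
  have h2 : X * derivative (centralSum p a) = ∑ k ∈ range p,
      C (k.centralBinom * (k * a k)) * X ^ k := X_mul_derivative_centralSum a
  calc _ = X * derivative (centralSum p a) - X * (4 * (X * derivative (centralSum p a))
        + 2 * centralSum p a) := by ring
    _ = _ := by
      nth_rewrite 2 [h2]
      rw [h, ← mul_sub]
      congr 1
      simp only [centralSum, mul_sum, ← sum_add_distrib, ← sum_sub_distrib]
      refine sum_congr rfl fun k _ => ?_
      simp only [map_mul, map_sub, map_add, map_ofNat]
      ring

/-! ### Degree bounds and endpoint values -/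

/-- The central binomials with `p/2 < k < p` vanish modulo `p`, which halves the degree in `x` and
offsets `x` being quadratic. -/
theorem natDegree_centralSum_comp_le (hp : 2 < p) (a : ℕ → ZMod p) :
    ((centralSum p a).comp (X * (1 - X))).natDegree ≤ p - 1 := by
  have hodd : p % 2 = 1 := Nat.odd_iff.mp ((Fact.out : p.Prime).odd_of_ne_two hp.ne')
  have h : (centralSum p a).natDegree ≤ (p - 1) / 2 := by
    refine natDegree_sum_le_of_forall_le _ _ fun k hk => ?_
    by_cases h : p < 2 * k
    · simp [centralBinom_eq_zero h (mem_range.mp hk)]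
    · exact (natDegree_C_mul_X_pow_le _ _).trans (by omega)
  have hx : (X * (1 - X) : (ZMod p)[X]).natDegree ≤ 2 := by compute_degree
  exact natDegree_comp_le.trans ((Nat.mul_le_mul h hx).trans (by omega))

theorem natDegree_one_sub_X_le : (1 - X : (ZMod p)[X]).natDegree ≤ 1 := by compute_degree

theorem natDegree_polylog_le (d : ℕ) : (polylog p d).natDegree ≤ p - 1 :=
  natDegree_sum_le_of_forall_le _ _ fun _ hk =>
    (natDegree_C_mul_X_pow_le _ _).trans (Nat.le_sub_one_of_lt (mem_range.mp hk))

theorem natDegree_polylog_comp_le (d : ℕ) :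
    ((polylog p d).comp (1 - X)).natDegree ≤ p - 1 :=
  natDegree_comp_le.trans
    ((Nat.mul_le_mul (natDegree_polylog_le d) natDegree_one_sub_X_le).trans (by simp))

theorem eval_zero_centralSum (a : ℕ → ZMod p) : (centralSum p a).eval 0 = a 0 := by
  have hp := (Fact.out : p.Prime).pos
  simp [centralSum, eval_finsetSum, zero_pow_eq, hp]

theorem eval_zero_polylog {d : ℕ} (hd : d ≠ 0) : (polylog p d).eval 0 = 0 := by
  simp [polylog, eval_finsetSum, zero_pow_eq, hd]

/-- Inversion permutes `ZMod p`, reducing this to the vanishing of power sums of exponent below `p -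
1`. -/
theorem eval_one_polylog {d : ℕ} (hd : d < p - 1) : (polylog p d).eval 1 = 0 := by
  simp only [polylog, eval_finsetSum, eval_mul, eval_C, eval_pow, eval_X, one_pow, mul_one]
  have h : ∑ k ∈ range p, ((k : ZMod p) ^ d)⁻¹ = ∑ x : ZMod p, (x ^ d)⁻¹ := by
    refine sum_bij (fun k _ => (k : ZMod p)) (fun _ _ => mem_univ _) ?_ ?_ fun _ _ => rfl
    · intro a ha b hb hab
      rwa [ZMod.natCast_eq_natCast_iff', Nat.mod_eq_of_lt (mem_range.mp ha),
        Nat.mod_eq_of_lt (mem_range.mp hb)] at hab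
    · exact fun b _ => ⟨b.val, mem_range.mpr b.val_lt, b.natCast_zmod_val⟩
  rw [h]
  simp only [← inv_pow]
  have h2 : ∑ x : ZMod p, x⁻¹ ^ d = ∑ x : ZMod p, x ^ d :=
    Equiv.sum_comp (Equiv.inv (ZMod p)) fun x => x ^ d
  rw [h2]
  exact FiniteField.sum_pow_lt_card_sub_one _ _ (by rwa [ZMod.card])

theorem sum_range_eq_add {M : Type*} [AddCommMonoid M] (f : ℕ → M) :
    ∑ k ∈ range p, f k = ∑ k ∈ range (p - 1), f (k + 1) + f 0 := by
  rw [← Finset.sum_range_succ', Nat.sub_add_cancel (Fact.out : p.Prime).one_le]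

/-! ### Derivatives of finite polylogarithms -/

theorem X_mul_derivative_polylog {d : ℕ} (hd : d ≠ 0) :
    X * derivative (polylog p (d + 1)) = polylog p d := by
  simp only [polylog, derivative_sum, mul_sum, derivative_C_mul_X_pow]
  refine sum_congr rfl fun k hk => ?_
  rcases k with _ | k
  · simp [hd]
  · have h := natCast_ne_zero k.succ_ne_zero (mem_range.mp hk)
    have h2 : (((k + 1 : ℕ) : ZMod p) ^ (d + 1))⁻¹ * ((k + 1 : ℕ) : ZMod p) =
        (((k + 1 : ℕ) : ZMod p) ^ d)⁻¹ := by
      rw [pow_succ, mul_inv, inv_mul_cancel_right₀ h]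
    rw [h2, Nat.add_sub_cancel]
    ring

theorem mul_derivative_polylog_one :
    X * (1 - X) * derivative (polylog p 1) = X - X ^ p := by
  have h : X * derivative (polylog p 1) + 1 = ∑ k ∈ range p, (X : (ZMod p)[X]) ^ k := by
    simp only [polylog, derivative_sum, mul_sum, derivative_C_mul_X_pow]
    rw [sum_range_eq_add (p := p), sum_range_eq_add (p := p)]
    simp only [Nat.cast_zero, mul_zero, C_0, zero_mul, add_zero, pow_zero]
    congr 1
    refine sum_congr rfl fun k hk => ?_
    have h := natCast_ne_zero (p := p) k.succ_ne_zero (by have := mem_range.mp hk; omega)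
    rw [pow_one, inv_mul_cancel₀ h, C_1, Nat.add_sub_cancel]
    ring
  have hg := mul_neg_geom_sum (X : (ZMod p)[X]) p
  rw [← h] at hg
  linear_combination hg

theorem derivative_polylog_comp (d : ℕ) : derivative ((polylog p d).comp (1 - X)) =
    -(derivative (polylog p d)).comp (1 - X) := by
  rw [derivative_comp]; simp

/-- By Frobenius, `X - X ^ p` changes sign under `X ↦ 1 - X`, cancelling the sign from the chain
rule. -/
theorem mul_derivative_polylog_one_comp :
    X * (1 - X) * derivative ((polylog p 1).comp (1 - X)) = X - X ^ p := by
  have h := congrArg (fun P => P.comp (1 - X)) (mul_derivative_polylog_one (p := p))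
  simp only [mul_comp, sub_comp, X_comp, one_comp, pow_comp] at h
  rw [sub_pow_char, one_pow] at h
  rw [derivative_polylog_comp]
  linear_combination -h

theorem one_sub_X_mul_derivative_polylog_comp {d : ℕ} (hd : d ≠ 0) :
    (1 - X) * derivative ((polylog p (d + 1)).comp (1 - X)) =
      -(polylog p d).comp (1 - X) := by
  rw [← X_mul_derivative_polylog hd, derivative_polylog_comp]
  simp

/-- Reflection symmetry of the finite logarithm. -/
theorem polylog_one_comp (hp : 2 < p) : (polylog p 1).comp (1 - X) = polylog p 1 := by
  rw [← sub_eq_zero]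
  refine eq_zero_of_mul_derivative_eq_zero ?_ ?_ ?_ ?_
  · exact (natDegree_sub_le_of_le (natDegree_polylog_comp_le 1) (natDegree_polylog_le 1)).trans
      (by omega)
  · rw [derivative_sub, mul_sub, mul_derivative_polylog_one, mul_derivative_polylog_one_comp,
      sub_self]
  · simp [eval_comp, eval_zero_polylog, eval_one_polylog (show 1 < p - 1 by omega)]
  · simp [eval_comp, eval_zero_polylog, eval_one_polylog (show 1 < p - 1 by omega)]

/-! ### The identities over `ZMod p` -/

theorem derivative_centralSum_comp (a : ℕ → ZMod p) :
    derivative ((centralSum p a).comp (X * (1 - X))) =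
      (1 - 2 * X) * (derivative (centralSum p a)).comp (X * (1 - X)) := by
  rw [derivative_comp]
  congr 1
  simp
  ring

theorem mul_derivative_centralSum_comp (a : ℕ → ZMod p) :
    X * (1 - X) * derivative ((centralSum p a).comp (X * (1 - X))) =
      (1 - 2 * X) * (centralSum p fun k => k * a k).comp (X * (1 - X)) := by
  rw [derivative_centralSum_comp, ← X_mul_derivative_centralSum, mul_comp, X_comp]
  ring

theorem derivative_mul_centralSum_comp (a : ℕ → ZMod p) :
    derivative ((1 - 2 * X) * (centralSum p a).comp (X * (1 - X))) =
      (centralSum p fun k => (4 * k + 2) * (a (k + 1) - a k)).comp (X * (1 - X)) := by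
  rw [← centralSum_ode, derivative_mul, derivative_centralSum_comp]
  simp only [derivative_sub, derivative_one, derivative_mul, derivative_X, derivative_ofNat,
    sub_comp, mul_comp, one_comp, ofNat_comp, X_comp]
  ring

theorem natDegree_mul_centralSum_comp_le (hp : 2 < p) (a : ℕ → ZMod p) :
    ((1 - 2 * X) * (centralSum p a).comp (X * (1 - X))).natDegree ≤ p := by
  have h : (1 - 2 * X : (ZMod p)[X]).natDegree ≤ 1 := by compute_degree
  exact (natDegree_mul_le_of_le h (natDegree_centralSum_comp_le hp a)).trans (by omega)

theorem mul_centralSum_one_comp (hp : 2 < p) :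
    (1 - 2 * X) * (centralSum p fun _ => 1).comp (X * (1 - X)) = 1 - 2 * X ^ p := by
  rw [← sub_eq_zero]
  have h0 := (Fact.out : p.Prime).ne_zero
  refine eq_zero_of_derivative_eq_zero ?_ ?_ ?_ ?_
  · have h : (1 - 2 * X ^ p : (ZMod p)[X]).natDegree ≤ p := by compute_degree!
    exact (natDegree_sub_le_of_le (natDegree_mul_centralSum_comp_le hp _) h).trans (by simp)
  · rw [derivative_sub, derivative_mul_centralSum_comp]
    simp [centralSum, derivative_X_pow]
  · simp [eval_comp, eval_zero_centralSum, h0]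
  · simp [eval_comp, eval_zero_centralSum]

theorem centralSum_inv_comp (hp : 2 < p) :
    (centralSum p fun k => (k : ZMod p)⁻¹).comp (X * (1 - X)) =
      (polylog p 1).comp (1 - X) + polylog p 1 := by
  rw [← sub_eq_zero]
  refine eq_zero_of_mul_derivative_eq_zero ?_ ?_ ?_ ?_
  · refine (natDegree_sub_le_of_le (natDegree_centralSum_comp_le hp _)
      (natDegree_add_le_of_le (natDegree_polylog_comp_le 1) (natDegree_polylog_le 1))).trans ?_
    simp
  -- The subtracted `1` is the `k = 0` term, lost because `0 * 0⁻¹ = 0`.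
  · have h : (centralSum p fun k => (k : ZMod p) * (k : ZMod p)⁻¹) =
        (centralSum p fun _ => 1) - 1 := by
      rw [eq_sub_iff_add_eq]
      simp only [centralSum]
      rw [sum_range_eq_add (p := p), sum_range_eq_add (p := p)]
      simp only [Nat.cast_zero, zero_mul, mul_zero, C_0, add_zero, Nat.centralBinom_zero,
        Nat.cast_one, mul_one, C_1, pow_zero]
      congr 1
      refine sum_congr rfl fun k hk => ?_
      rw [mul_inv_cancel₀, mul_one]
      exact natCast_ne_zero k.succ_ne_zero (by have := mem_range.mp hk; omega)
    have hG := mul_centralSum_one_comp hp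
    rw [derivative_sub, derivative_add, mul_sub, mul_add, mul_derivative_polylog_one,
      mul_derivative_polylog_one_comp, mul_derivative_centralSum_comp, h, sub_comp, one_comp]
    linear_combination hG
  · simp [eval_comp, eval_zero_centralSum, eval_zero_polylog,
      eval_one_polylog (show 1 < p - 1 by omega)]
  · simp [eval_comp, eval_zero_centralSum, eval_zero_polylog,
      eval_one_polylog (show 1 < p - 1 by omega)]

theorem natCast_mul_inv_pow_succ (k : ℕ) {d : ℕ} (hd : d ≠ 0) :
    (k : ZMod p) * ((k : ZMod p) ^ (d + 1))⁻¹ = ((k : ZMod p) ^ d)⁻¹ := by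
  by_cases h : (k : ZMod p) = 0
  · simp [h, hd]
  · rw [pow_succ', mul_inv, mul_inv_cancel_left₀ h]

theorem centralSum_inv_sq_comp (hp : 3 < p) :
    (centralSum p fun k => ((k : ZMod p) ^ 2)⁻¹).comp (X * (1 - X)) =
      2 * (polylog p 2).comp (1 - X) + 2 * polylog p 2 := by
  rw [← sub_eq_zero]
  refine eq_zero_of_mul_derivative_eq_zero ?_ ?_ ?_ ?_
  · have h1 := natDegree_centralSum_comp_le (by omega) fun k => ((k : ZMod p) ^ 2)⁻¹
    have h2 := natDegree_polylog_comp_le (p := p) 2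
    have h3 := natDegree_polylog_le (p := p) 2
    refine (natDegree_sub_le_of_le h1 (natDegree_add_le_of_le
      (natDegree_mul_le_of_le (natDegree_ofNat 2).le h2)
      (natDegree_mul_le_of_le (natDegree_ofNat 2).le h3))).trans ?_
    simp
  · have hS := mul_derivative_centralSum_comp fun k => ((k : ZMod p) ^ 2)⁻¹
    simp only [natCast_mul_inv_pow_succ _ one_ne_zero, pow_one] at hS
    rw [centralSum_inv_comp (by omega)] at hS
    have hL := X_mul_derivative_polylog (p := p) one_ne_zero
    have hA := one_sub_X_mul_derivative_polylog_comp (p := p) one_ne_zero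
    have hsym := polylog_one_comp (p := p) (by omega)
    simp only [derivative_sub, derivative_add, derivative_mul, derivative_ofNat, zero_mul,
      zero_add] at *
    -- The derivatives differ by `£_1(α) - £_1(β)`, which reflection kills.
    linear_combination hS - 2 * (1 - X) * hL - 2 * X * hA + hsym
  · simp [eval_comp, eval_zero_centralSum, eval_zero_polylog,
      eval_one_polylog (show 2 < p - 1 by omega)]
  · simp [eval_comp, eval_zero_centralSum, eval_zero_polylog,
      eval_one_polylog (show 2 < p - 1 by omega)]

variable (p) in
/-- The coefficients `H_k^{(2)} + 1 / k ^ 2`. -/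
noncomputable def harmonicCoeff (k : ℕ) : ZMod p :=
  ∑ j ∈ Icc 1 k, ((j : ZMod p) ^ 2)⁻¹ + ((k : ZMod p) ^ 2)⁻¹

/-- The coefficient difference is `2/(k+1)² - 1/k²`: an index shift turns the first part into
weights `1/k`, and the second splits as `(4k + 2)/k² = 4/k + 2/k²`. -/
theorem X_mul_centralSum_harmonicCoeff :
    (X * centralSum p fun k => (4 * k + 2) * (harmonicCoeff p (k + 1) - harmonicCoeff p k)) =
      2 * (1 - 2 * X) * (centralSum p fun k => (k : ZMod p)⁻¹) -
        2 * X * centralSum p fun k => ((k : ZMod p) ^ 2)⁻¹ := by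
  have h : (centralSum p fun k => (k : ZMod p)⁻¹) = X * ∑ k ∈ range p,
      C ((4 * k + 2) * (k.centralBinom : ZMod p) * (((k : ZMod p) + 1) ^ 2)⁻¹) * X ^ k := by
    rw [centralSum, sum_range_shift (by simp) (by simp)]
    congr 1
    refine sum_congr rfl fun k _ => ?_
    rw [← centralBinom_succ_mul, ← Nat.cast_succ]
    have h2 := natCast_mul_inv_pow_succ (p := p) (k + 1) one_ne_zero
    rw [pow_one] at h2
    rw [← h2]
    congr 2
    ring
  have h4 : 2 * (1 - 2 * X) * (centralSum p fun k => (k : ZMod p)⁻¹) =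
      2 * (centralSum p fun k => (k : ZMod p)⁻¹) -
        X * (4 * centralSum p fun k => (k : ZMod p)⁻¹) := by ring
  rw [h4]
  nth_rewrite 1 [h]
  rw [mul_left_comm 2 X, mul_assoc 2 X, mul_left_comm 2 X, ← mul_sub, ← mul_sub]
  congr 1
  simp only [centralSum, mul_sum, ← sum_sub_distrib]
  refine sum_congr rfl fun k _ => ?_
  have h5 : harmonicCoeff p (k + 1) - harmonicCoeff p k =
      2 * (((k : ZMod p) + 1) ^ 2)⁻¹ - ((k : ZMod p) ^ 2)⁻¹ := by
    simp only [harmonicCoeff]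
    rw [Finset.sum_Icc_succ_top (by omega)]
    push_cast
    ring
  have h6 := congrArg (C : ZMod p → (ZMod p)[X]) (natCast_mul_inv_pow_succ (p := p) k one_ne_zero)
  rw [pow_one] at h6
  simp only [h5, map_mul, map_sub, map_add, map_ofNat] at h6 ⊢
  linear_combination (-4) * C (k.centralBinom : ZMod p) * X ^ k * h6

theorem mul_centralSum_harmonicCoeff_comp (hp : 3 < p) :
    (1 - 2 * X) * (centralSum p (harmonicCoeff p)).comp (X * (1 - X)) =
      4 * ((1 - X) * polylog p 2 - X * (polylog p 2).comp (1 - X)) := by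
  rw [← sub_eq_zero]
  have hz : harmonicCoeff p 0 = 0 := by simp [harmonicCoeff]
  refine eq_zero_of_mul_derivative_eq_zero ?_ ?_ ?_ ?_
  · have h1 := natDegree_mul_centralSum_comp_le (by omega) (harmonicCoeff p)
    have h2 := natDegree_polylog_comp_le (p := p) 2
    have h3 := natDegree_polylog_le (p := p) 2
    refine (natDegree_sub_le_of_le h1 (natDegree_mul_le_of_le (natDegree_ofNat 4).le
      (natDegree_sub_le_of_le (natDegree_mul_le_of_le natDegree_one_sub_X_le h3)
      (natDegree_mul_le_of_le natDegree_X_le h2)))).trans ?_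
    simp
    omega
  · have hS := congrArg (fun P => P.comp (X * (1 - X)))
      (X_mul_centralSum_harmonicCoeff (p := p))
    simp only [mul_comp, sub_comp, X_comp, ofNat_comp, one_comp] at hS
    rw [centralSum_inv_comp (by omega), centralSum_inv_sq_comp hp] at hS
    have hL := X_mul_derivative_polylog (p := p) one_ne_zero
    have hA := one_sub_X_mul_derivative_polylog_comp (p := p) one_ne_zero
    have hsym := polylog_one_comp (p := p) (by omega)
    rw [derivative_sub, derivative_mul_centralSum_comp, mul_sub, hS]
    simp only [derivative_sub, derivative_mul, derivative_ofNat, derivative_X,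
      derivative_one] at *
    linear_combination (-4) * (1 - X) ^ 2 * hL + 4 * X ^ 2 * hA +
      (2 - 4 * X) * hsym
  · simp [eval_comp, eval_zero_centralSum, eval_zero_polylog, hz]
  · simp [eval_comp, eval_zero_centralSum, eval_zero_polylog, hz]

theorem centralSum_harmonicCoeff_div_comp (hp : 3 < p) :
    (centralSum p fun k => harmonicCoeff p k * (k : ZMod p)⁻¹).comp (X * (1 - X)) =
      4 * (polylog p 3).comp (1 - X) + 4 * polylog p 3 := by
  have h3 : 3 < p - 1 := by
    have : p ≠ 4 := fun h => absurd (Fact.out : p.Prime) (by rw [h]; decide)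
    omega
  rw [← sub_eq_zero]
  refine eq_zero_of_mul_derivative_eq_zero ?_ ?_ ?_ ?_
  · have h1 := natDegree_centralSum_comp_le (by omega)
      fun k => harmonicCoeff p k * (k : ZMod p)⁻¹
    have h2 := natDegree_polylog_comp_le (p := p) 3
    have h3 := natDegree_polylog_le (p := p) 3
    refine (natDegree_sub_le_of_le h1 (natDegree_add_le_of_le
      (natDegree_mul_le_of_le (natDegree_ofNat 4).le h2)
      (natDegree_mul_le_of_le (natDegree_ofNat 4).le h3))).trans ?_
    simp
  · have hS := mul_derivative_centralSum_comp fun k => harmonicCoeff p k * (k : ZMod p)⁻¹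
    have h : (centralSum p fun k => (k : ZMod p) * (harmonicCoeff p k * (k : ZMod p)⁻¹)) =
        centralSum p (harmonicCoeff p) := by
      refine sum_congr rfl fun k hk => ?_
      rcases k with _ | k
      · simp [harmonicCoeff]
      · dsimp only
        rw [mul_comm (harmonicCoeff p _), mul_inv_cancel_left₀
          (natCast_ne_zero k.succ_ne_zero (mem_range.mp hk))]
    rw [h, mul_centralSum_harmonicCoeff_comp hp] at hS
    have hL := X_mul_derivative_polylog (p := p) two_ne_zero
    have hA := one_sub_X_mul_derivative_polylog_comp (p := p) two_ne_zero
    simp only [derivative_sub, derivative_add, derivative_mul, derivative_ofNat, zero_mul,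
      zero_add] at *
    linear_combination hS - 4 * (1 - X) * hL - 4 * X * hA
  · simp [eval_comp, eval_zero_centralSum, eval_zero_polylog,
      eval_one_polylog h3]
  · simp [eval_comp, eval_zero_centralSum, eval_zero_polylog,
      eval_one_polylog h3]

/-! ### Transfer to `ℤ_[p]` -/

theorem smodEq_of_map_eq {f g : ℤ_[p][X]}
    (h : f.map PadicInt.toZMod = g.map PadicInt.toZMod) :
    f ≡ g [SMOD Ideal.span {(p : ℤ_[p][X])}] := by
  rw [SModEq.sub_mem, Ideal.mem_span_singleton, ← C_eq_natCast, C_dvd_iff_dvd_coeff]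
  intro i
  rw [← Ideal.mem_span_singleton, ← PadicInt.maximalIdeal_eq_span_p, ← PadicInt.ker_toZMod,
    RingHom.mem_ker, coeff_sub, map_sub, ← coeff_map, ← coeff_map, h, sub_self]

theorem toZMod_padicRecip {n : ℕ} (h : p.Coprime n) :
    PadicInt.toZMod (padicRecip p n) = (n : ZMod p)⁻¹ := by
  refine eq_inv_of_mul_eq_one_left ?_
  simpa using congrArg PadicInt.toZMod (padicRecip_mul_cancel p h)

theorem coprime_of_mem_Icc {k : ℕ} (hk : k ∈ Icc 1 (p - 1)) : p.Coprime k := by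
  have := mem_Icc.mp hk
  exact (Nat.coprime_of_lt_prime (n := k) (p := p) (by omega) (by omega) Fact.out)

theorem sum_Icc_eq_sum_range {M : Type*} [AddCommMonoid M] {f : ℕ → M} (h : f 0 = 0) :
    ∑ k ∈ Icc 1 (p - 1), f k = ∑ k ∈ range p, f k := by
  have hp := (Fact.out : p.Prime).pos
  refine sum_subset (fun k hk => ?_) fun k hk hk2 => ?_
  · have := mem_Icc.mp hk
    exact mem_range.mpr (by omega)
  · have h1 := mem_range.mp hk
    have h2 : k = 0 := by
      by_contra h3
      exact hk2 (mem_Icc.mpr (by omega))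
    rw [h2, h]

theorem map_finitePolylog {d : ℕ} (hd : d ≠ 0) (f : ℤ_[p][X]) :
    (finitePolylog p d f).map PadicInt.toZMod =
      (polylog p d).comp (f.map PadicInt.toZMod) := by
  rw [finitePolylog, polylog, ← sum_Icc_eq_sum_range (by simp [hd]), Polynomial.map_sum]
  simp only [← coe_compRingHom_apply, map_sum]
  refine sum_congr rfl fun k hk => ?_
  simp [toZMod_padicRecip ((coprime_of_mem_Icc hk).pow_right d)]

theorem map_centralSum {a : ℕ → ℤ_[p]} {b : ℕ → ZMod p} (h0 : b 0 = 0)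
    (h : ∀ k ∈ Icc 1 (p - 1), PadicInt.toZMod (a k) = b k) :
    (∑ k ∈ Icc 1 (p - 1), ((2 * k).choose k : ℤ_[p][X]) * C (a k) * (X * (1 - X)) ^ k).map
      PadicInt.toZMod = (centralSum p b).comp (X * (1 - X)) := by
  rw [centralSum, ← sum_Icc_eq_sum_range (by simp [h0]), Polynomial.map_sum]
  simp only [← coe_compRingHom_apply, map_sum]
  refine sum_congr rfl fun k hk => ?_
  simp [h k hk, Nat.centralBinom_eq_two_mul_choose]

theorem toZMod_genHarmonic {k : ℕ} (hk : k ∈ Icc 1 (p - 1)) :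
    PadicInt.toZMod (genHarmonic p 2 k) = ∑ j ∈ Icc 1 k, ((j : ZMod p) ^ 2)⁻¹ := by
  rw [genHarmonic, map_sum]
  refine sum_congr rfl fun j hj => ?_
  have hj' : j ∈ Icc 1 (p - 1) := by
    have h1 := mem_Icc.mp hk
    have h2 := mem_Icc.mp hj
    exact mem_Icc.mpr (by omega)
  rw [toZMod_padicRecip ((coprime_of_mem_Icc hj').pow_right 2), Nat.cast_pow]

end FinitePolylog

open FinitePolylog in
theorem mainTheorem1 (p : ℕ) [Fact p.Prime] (hp : 3 < p) :
    let β : ℤ_[p][X] := X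
    let α : ℤ_[p][X] := 1 - β
    let x : ℤ_[p][X] := β * (1 - β)
    (∑ k ∈ Finset.Icc 1 (p - 1),
        ((2 * k).choose k : ℤ_[p][X]) * C (padicRecip p k) * x ^ k
      ≡ finitePolylog p 1 α + finitePolylog p 1 β
        [SMOD Ideal.span {(p : ℤ_[p][X])}]) ∧
    (∑ k ∈ Finset.Icc 1 (p - 1),
        ((2 * k).choose k : ℤ_[p][X]) * C (padicRecip p (k ^ 2)) * x ^ k
      ≡ 2 * finitePolylog p 2 α + 2 * finitePolylog p 2 β
        [SMOD Ideal.span {(p : ℤ_[p][X])}]) ∧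
    (∑ k ∈ Finset.Icc 1 (p - 1),
        ((2 * k).choose k : ℤ_[p][X]) *
          C (genHarmonic p 2 k * padicRecip p k + padicRecip p (k ^ 3)) * x ^ k
      ≡ 4 * finitePolylog p 3 α + 4 * finitePolylog p 3 β
        [SMOD Ideal.span {(p : ℤ_[p][X])}]) := by
  intro β α x
  refine ⟨smodEq_of_map_eq ?_, smodEq_of_map_eq ?_, smodEq_of_map_eq ?_⟩
  · rw [map_centralSum (b := fun k => (k : ZMod p)⁻¹) (by simp)
      fun k hk => toZMod_padicRecip (coprime_of_mem_Icc hk), centralSum_inv_comp (by omega)]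
    simp [map_finitePolylog, α, β]
  · rw [map_centralSum (b := fun k => ((k : ZMod p) ^ 2)⁻¹) (by simp) fun k hk => by
        rw [toZMod_padicRecip ((coprime_of_mem_Icc hk).pow_right 2), Nat.cast_pow],
      centralSum_inv_sq_comp hp]
    simp [map_finitePolylog, α, β]
  · rw [map_centralSum (b := fun k => harmonicCoeff p k * (k : ZMod p)⁻¹) (by simp)
        fun k hk => by
          rw [map_add, map_mul, toZMod_genHarmonic hk, toZMod_padicRecip (coprime_of_mem_Icc hk),
            toZMod_padicRecip ((coprime_of_mem_Icc hk).pow_right 3), Nat.cast_pow, harmonicCoeff]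
          ring,
      centralSum_harmonicCoeff_div_comp hp]
    simp [map_finitePolylog, α, β]
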